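/- **Lower bound for LCS-RLE without prefix-sum oracles.** An RLE string $S$ of encoded length $n$ over a character set $\Sigma$ is a sequence of $n$ runs $S[1]\cdots S[n]$, where $S[i]$ has a character $C(S[i])\in\Sigma$ and a length $R(S[i])\ge 1$, and neighbouring runs have different characters; its decoding $\tilde S$ is the concatenation of $R(S[i])$ copies of $C(S[i])$ for $i=1,\dots,n$, and its decoded length is $|\tilde S|$. In the problem $\mathsf{LCS\text{-}RLE}$ the input is a pair $(A,B)$ of RLE strings, and a correct output is a triple $(i_A,i_B,\ell)$ for which there is an RLE string $s$ of encoded length $\ell$ such that $\tilde s$ is a longest common (contiguous) substring of $\tilde A$ and $\tilde B$, some instance of $\tilde s$ in $\tilde A$ starts within the run $A[i_A]$, and some instance of $\tilde s$ in $\tilde B$ starts within the run $B[i_B]$. A quantum query algorithm may access $A$ and $B$ only through the unitary oracles $$O_S:\ |i\rangle|c\rangle|r\rangle\mapsto|i\rangle|c\oplus C(S[i])\rangle|r\oplus R(S[i])\rangle\qquad(S\in\{A,B\}),$$ where characters and run lengths are written in binary and $\oplus$ is bitwise XOR; the algorithm chooses, possibly in superposition, which of the two oracles a query addresses. It has no prefix-sum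 oracle. Between queries it applies arbitrary input-independent unitaries on its registers and a finite-dimensional work space, and at the end it measures. There are constants $c>0$ and $n_0$ such that the following holds for all $n\ge n_0$, every finite character set $\Sigma$ with at least two elements, and every $\tilde n\ge 8n$: every quantum query algorithm which, on every input $(A,B)$ consisting of two RLE strings over $\Sigma$ of encoded length $n$ and decoded length at most $\tilde n$ whose decodings have a character in common, outputs a correct answer to $\mathsf{LCS\text{-}RLE}$ with probability at least $2/3$, makes at least $c\,n/\log^2 n$ queries. In particular it needs $\tilde\Omega(n)$ queries. -/

import Mathlib

namespace LCSRLE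

/-- A run-length encoded string over the character set `α` with exactly `n` runs: run `i` consists
of `run i ≥ 1` copies of `char i`, and runs are maximal (neighbouring runs have different
characters). Runs are numbered from `0`. -/
@[ext]
structure RLE (α : Type*) (n : ℕ) where
  char : Fin n → α
  run : Fin n → ℕ
  run_pos : ∀ i, 0 < run i
  maximal : ∀ i j : Fin n, (j : ℕ) = i + 1 → char i ≠ char j

namespace RLE

variable {α : Type*} {n : ℕ}

/-- The decoded string. -/
def decode (S : RLE α n) : List α :=
  (List.ofFn fun i => List.replicate (S.run i) (S.char i)).flatten

/-- The number of characters of the decoded string that precede run `i`. -/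
def start (S : RLE α n) (i : Fin n) : ℕ :=
  ∑ j ∈ Finset.Iio i, S.run j

/-- Some instance of the string `t` in the decoded string of `S` starts within run `i` of `S`. -/
def StartsWithin (S : RLE α n) (i : Fin n) (t : List α) : Prop :=
  ∃ u v : List α, S.decode = u ++ t ++ v ∧
    S.start i ≤ u.length ∧ u.length < S.start i + S.run i

end RLE

/-- `s` is a longest common (contiguous) substring of `x` and `y`. -/
def IsLCS {α : Type*} (s x y : List α) : Prop :=
  s <:+: x ∧ s <:+: y ∧ ∀ t : List α, t <:+: x → t <:+: y → t.length ≤ s.length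

/-- `(iA, iB, ℓ)` is a correct output of the problem LCS-RLE on the input `(A, B)`: there is an RLE
string `s` of encoded length `ℓ` whose decoding is a longest common substring of the decodings of
`A` and `B`, with an instance starting within run `iA` of `A` and one starting within run `iB` of
`B`. -/
def IsAnswer {α : Type*} {n : ℕ} (A B : RLE α n) (o : Fin n × Fin n × ℕ) : Prop :=
  ∃ s : RLE α o.2.2, IsLCS s.decode A.decode B.decode ∧
    A.StartsWithin o.1 s.decode ∧ B.StartsWithin o.2.1 s.decode

/-- Labels of the computational basis states `|s⟩|i⟩|c⟩|r⟩|w⟩`: a bit selecting which of the two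
input strings is queried, an index of a run, a `b`-bit character register, an `m`-bit run-length
register, and a work register of dimension `d`. -/
abbrev BasisState (n b m d : ℕ) : Type :=
  Bool × Fin n × BitVec b × BitVec m × Fin d

/-- The action of the input oracle on basis states:
`|s⟩|i⟩|c⟩|r⟩|w⟩ ↦ |s⟩|i⟩|c ⊕ C(S[i])⟩|r ⊕ R(S[i])⟩|w⟩`, where `S = A` if `s` is false and `S = B`
if `s` is true, characters are encoded by `enc`, run lengths are written in binary, and `⊕` is
bitwise XOR. -/
def queryMap {α : Type*} {n b m d : ℕ} (enc : α ↪ BitVec b) (A B : RLE α n) :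
    BasisState n b m d → BasisState n b m d :=
  fun (s, i, c, r, w) =>
    (s, i, c ^^^ enc ((bif s then B else A).char i),
      r ^^^ BitVec.ofNat m ((bif s then B else A).run i), w)

theorem queryMap_involutive {α : Type*} {n b m d : ℕ} (enc : α ↪ BitVec b) (A B : RLE α n) :
    Function.Involutive (queryMap (m := m) (d := d) enc A B) := by
  rintro ⟨s, i, c, r, w⟩
  simp [queryMap]

/-- The oracle as a matrix: the linear extension of `queryMap`. It permutes the basis states. -/
def oracle {α : Type*} {n b m : ℕ} (d : ℕ) (enc : α ↪ BitVec b) (A B : RLE α n) :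
    Matrix (BasisState n b m d) (BasisState n b m d) ℂ :=
  Matrix.of fun y x => if y = queryMap enc A B x then 1 else 0

/-- A quantum query algorithm `U_T O U_{T-1} O ⋯ O U_0` making `T = queries` oracle calls on inputs
with `n` runs per string: it starts in a basis state, interleaves the oracle with
input-independent unitaries (only `unitary 0, …, unitary T` are used), finally measures all
registers in the computational basis and outputs a function of the outcome. -/
structure QueryAlgorithm (n b m : ℕ) where
  queries : ℕ
  workDim : ℕ
  init : BasisState n b m workDim
  unitary : ℕ → Matrix.unitaryGroup (BasisState n b m workDim) ℂ
  output : BasisState n b m workDim → Fin n × Fin n × ℕ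

namespace QueryAlgorithm

variable {α : Type*} {n b m : ℕ}

/-- The state after `t` queries and the unitary that follows the last one of them. -/
def state (𝒜 : QueryAlgorithm n b m) (enc : α ↪ BitVec b) (A B : RLE α n) :
    ℕ → BasisState n b m 𝒜.workDim → ℂ
  | 0 => (𝒜.unitary 0).1.mulVec (Pi.single 𝒜.init 1)
  | t + 1 => (𝒜.unitary (t + 1)).1.mulVec
      ((oracle 𝒜.workDim enc A B).mulVec (𝒜.state enc A B t))

/-- The probability that the output of the algorithm on the input `(A, B)` lies in `E`. -/
noncomputable def outputProb (𝒜 : QueryAlgorithm n b m) (enc : α ↪ BitVec b) (A B : RLE α n)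
    (E : Set (Fin n × Fin n × ℕ)) : ℝ :=
  ∑ z, (𝒜.output ⁻¹' E).indicator (fun z => ‖𝒜.state enc A B 𝒜.queries z‖ ^ 2) z

/-- The algorithm solves LCS-RLE with probability at least `2/3` on all inputs `(A, B)` that consist
of two RLE strings of encoded length `n` and decoded length at most `N`. Nothing is required of the
algorithm if the decoded strings have no character in common (i.e. the LCS is empty). -/
def SolvesLCSRLE (𝒜 : QueryAlgorithm n b m) (enc : α ↪ BitVec b) (N : ℕ) : Prop :=
  ∀ A B : RLE α n, A.decode.length ≤ N → B.decode.length ≤ N →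
    (∃ x, x ∈ A.decode ∧ x ∈ B.decode) →
    2 / 3 ≤ 𝒜.outputProb enc A B {o | IsAnswer A B o}

end QueryAlgorithm

end LCSRLE

namespace LCSRLE

variable {α : Type*} {n b m d : ℕ}

/-! Deciding whether a subset `x` of `{0, …, K - 1}` has `t` or `t + 1` elements, for `t` about `K /
2`, takes a linear number of quantum membership queries, and LCS-RLE solves this problem with `K = n
/ 2`. Both inputs contain the string `c ⋯ c a c ⋯ c a ⋯`, whose `j`-th run of `c` has length 5 or 1
according to `j ∈ x`, so its length is `2 * K + 4 * x.card`. In `inputA` a run of `L + 1` letters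
`a` precedes it; in `inputB` such a run stands at the end. A common substring is therefore either
constant or essentially confined to the code of `x`. With `L` between the two possible code lengths,
the output `ℓ` is at most 1 for `t` elements and at least 2 for `t + 1` (`le_one_of_isAnswer`,
`not_le_one_of_isAnswer`). Without prefix sums, a query depends on at most one element of `x`.

The query bound is an adversary argument (`le_queries_of_distinguishes`): the overlaps of the states
on `x` and `insert j x`, summed over all such pairs, drop slowly per query but must end bounded away
from 1. The resulting linear bound is stronger than the one with `log ^ 2`, as `log n ≥ 1` for `n ≥
4`. -/

/-! ### Oracle calls and overlaps of states -/

theorem oracle_mulVec_apply (enc : α ↪ BitVec b) (A B : RLE α n) (ψ : BasisState n b m d → ℂ)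
    (z : BasisState n b m d) :
    ((oracle d enc A B).mulVec ψ) z = ψ (queryMap enc A B z) := by
  have h : ∀ x, (z = queryMap enc A B x) ↔ (queryMap enc A B z = x) := fun x =>
    ⟨fun h => by rw [h, queryMap_involutive], fun h => by rw [← h, queryMap_involutive]⟩
  simp [Matrix.mulVec, dotProduct, oracle, h]

/-- The real part of the inner product of two state vectors. -/
def overlap {ι : Type*} [Fintype ι] (ψ φ : ι → ℂ) : ℝ := (star ψ ⬝ᵥ φ).re

theorem overlap_eq_sum {ι : Type*} [Fintype ι] (ψ φ : ι → ℂ) :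
    overlap ψ φ = ∑ z, (star (ψ z) * φ z).re := by
  simp [overlap, dotProduct]

theorem overlap_self {ι : Type*} [Fintype ι] (ψ : ι → ℂ) :
    overlap ψ ψ = ∑ z, ‖ψ z‖ ^ 2 := by
  rw [overlap_eq_sum]
  refine Finset.sum_congr rfl fun z _ => ?_
  rw [← Complex.normSq_eq_norm_sq, Complex.normSq_apply]
  simp

theorem overlap_unitary {ι : Type*} [Fintype ι] [DecidableEq ι] (U : Matrix.unitaryGroup ι ℂ)
    (ψ φ : ι → ℂ) : overlap (U.1.mulVec ψ) (U.1.mulVec φ) = overlap ψ φ := by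
  have h : star U.1 * U.1 = 1 := Matrix.UnitaryGroup.star_mul_self U
  rw [overlap, overlap, Matrix.star_mulVec, Matrix.dotProduct_mulVec, Matrix.vecMul_vecMul,
    ← Matrix.star_eq_conjTranspose, h, Matrix.vecMul_one]

theorem abs_re_star_mul_le (u v : ℂ) : |(star u * v).re| ≤ (‖u‖ ^ 2 + ‖v‖ ^ 2) / 2 := by
  have h : |(star u * v).re| ≤ ‖u‖ * ‖v‖ := by
    simpa using Complex.abs_re_le_norm (star u * v)
  nlinarith [sq_nonneg (‖u‖ - ‖v‖)]

/-- The overlap of two states whose outcome distributions are distinguished by the event `E` with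
error at most `1/3` is bounded away from `1`. -/
theorem overlap_le_of_distinguished {ι : Type*} [Fintype ι] (E : Set ι) (ψ φ : ι → ℂ)
    (hψ : ∑ z, ‖ψ z‖ ^ 2 = 1) (hφ : ∑ z, ‖φ z‖ ^ 2 = 1)
    (h₁ : 2 / 3 ≤ ∑ z, E.indicator (fun z => ‖ψ z‖ ^ 2) z)
    (h₂ : 2 / 3 ≤ ∑ z, Eᶜ.indicator (fun z => ‖φ z‖ ^ 2) z) :
    overlap ψ φ ≤ 17 / 18 := by
  -- Weighted AM-GM: the favoured state gets weight `2/3 - 7/24 = 3/8` and the other `2/3`, with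
  -- product `1/4`. Summation gives `4/3 - 7/24 * 4/3 = 17/18`.
  have key : ∀ z, (star (ψ z) * φ z).re ≤
      2 / 3 * ‖ψ z‖ ^ 2 - 7 / 24 * E.indicator (fun z => ‖ψ z‖ ^ 2) z
      + (2 / 3 * ‖φ z‖ ^ 2 - 7 / 24 * Eᶜ.indicator (fun z => ‖φ z‖ ^ 2) z) := by
    intro z
    have h : (star (ψ z) * φ z).re ≤ ‖ψ z‖ * ‖φ z‖ := by
      simpa using Complex.re_le_norm (star (ψ z) * φ z)
    by_cases hz : z ∈ E
    · simp only [Set.indicator_of_mem hz, Set.indicator_of_notMem (Set.notMem_compl_iff.2 hz)]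
      nlinarith [sq_nonneg (3 * ‖ψ z‖ - 4 * ‖φ z‖)]
    · simp only [Set.indicator_of_notMem hz, Set.indicator_of_mem (Set.mem_compl hz)]
      nlinarith [sq_nonneg (4 * ‖ψ z‖ - 3 * ‖φ z‖)]
  rw [overlap_eq_sum]
  refine (Finset.sum_le_sum fun z _ => key z).trans ?_
  rw [Finset.sum_add_distrib, Finset.sum_sub_distrib, Finset.sum_sub_distrib, ← Finset.mul_sum,
    ← Finset.mul_sum, ← Finset.mul_sum, ← Finset.mul_sum, hψ, hφ]
  linarith

/-- The weight of a state on the basis states that query a position labelled `j`. -/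
noncomputable def queryWeight (lab : Bool → Fin n → ℕ) (ψ : BasisState n b m d → ℂ) (j : ℕ) : ℝ :=
  ∑ z with lab z.1 z.2.1 = j, ‖ψ z‖ ^ 2

theorem sum_queryWeight_le (lab : Bool → Fin n → ℕ) (ψ : BasisState n b m d → ℂ) (s : Finset ℕ) :
    ∑ j ∈ s, queryWeight lab ψ j ≤ ∑ z, ‖ψ z‖ ^ 2 := by
  unfold queryWeight
  rw [Finset.sum_fiberwise_eq_sum_filter]
  exact Finset.sum_le_sum_of_subset_of_nonneg (Finset.filter_subset _ _) fun _ _ _ => by positivity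

/-- A query never changes the selector bit or the index register, so it permutes each class of basis
states defined by these two. -/
theorem sum_filter_queryMap {M : Type*} [AddCommMonoid M] (enc : α ↪ BitVec b) (A B : RLE α n)
    (p : Bool → Fin n → Prop) [∀ s i, Decidable (p s i)] (f : BasisState n b m d → M) :
    ∑ z with p z.1 z.2.1, f (queryMap enc A B z) = ∑ z with p z.1 z.2.1, f z := by
  refine Finset.sum_nbij' (queryMap enc A B) (queryMap enc A B) ?_ ?_ ?_ ?_ ?_
  · intro z hz; simpa [queryMap] using hz
  · intro z hz; simpa [queryMap] using hz
  · intro z _; exact queryMap_involutive enc A B z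
  · intro z _; exact queryMap_involutive enc A B z
  · intro z _; rfl

theorem sum_queryMap {M : Type*} [AddCommMonoid M] (enc : α ↪ BitVec b) (A B : RLE α n)
    (f : BasisState n b m d → M) : ∑ z, f (queryMap enc A B z) = ∑ z, f z := by
  simpa using sum_filter_queryMap enc A B (fun _ _ => True) f

theorem queryMap_congr (enc : α ↪ BitVec b) {A B A' B' : RLE α n} (z : BasisState n b m d)
    (h : (bif z.1 then B else A).char z.2.1 = (bif z.1 then B' else A').char z.2.1 ∧
      (bif z.1 then B else A).run z.2.1 = (bif z.1 then B' else A').run z.2.1) :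
    queryMap enc A B z = queryMap enc A' B' z := by
  obtain ⟨s, i, c, r, w⟩ := z
  simp only at h
  simp [queryMap, h.1, h.2]

/-- One oracle call changes the overlap of the states on two inputs that agree outside the
positions labelled `j` by at most the total weight on these positions. -/
theorem overlap_sub_overlap_oracle_le (enc : α ↪ BitVec b) {A B A' B' : RLE α n}
    (lab : Bool → Fin n → ℕ) (j : ℕ)
    (h : ∀ s i, lab s i ≠ j → (bif s then B else A).char i = (bif s then B' else A').char i ∧
      (bif s then B else A).run i = (bif s then B' else A').run i)
    (ψ φ : BasisState n b m d → ℂ) :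
    overlap ψ φ - overlap ((oracle d enc A B).mulVec ψ) ((oracle d enc A' B').mulVec φ) ≤
      queryWeight lab ψ j + queryWeight lab φ j := by
  simp only [overlap_eq_sum, oracle_mulVec_apply]
  rw [← Finset.sum_filter_add_sum_filter_not Finset.univ
      (fun z : BasisState n b m d => lab z.1 z.2.1 = j),
    ← Finset.sum_filter_add_sum_filter_not Finset.univ
      (fun z : BasisState n b m d => lab z.1 z.2.1 = j) (fun z => (star (ψ (queryMap enc A B z)) *
        φ (queryMap enc A' B' z)).re)]
  -- Off label `j` both oracles are the same permutation, so this part of the overlap is preserved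
  -- exactly; only the part on label `j` can change.
  have h₁ : ∑ z : BasisState n b m d with ¬ lab z.1 z.2.1 = j,
      (star (ψ (queryMap enc A B z)) * φ (queryMap enc A' B' z)).re =
      ∑ z : BasisState n b m d with ¬ lab z.1 z.2.1 = j, (star (ψ z) * φ z).re := by
    rw [← sum_filter_queryMap enc A B (fun s i => ¬ lab s i = j) fun z => (star (ψ z) * φ z).re]
    refine Finset.sum_congr rfl fun z hz => ?_
    rw [queryMap_congr enc z (h z.1 z.2.1 (Finset.mem_filter.1 hz).2)]
  have h₂ : ∑ z : BasisState n b m d with lab z.1 z.2.1 = j, (star (ψ z) * φ z).re ≤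
      (queryWeight lab ψ j + queryWeight lab φ j) / 2 := by
    rw [queryWeight, queryWeight, ← Finset.sum_add_distrib, Finset.sum_div]
    exact Finset.sum_le_sum fun z _ => (abs_le.1 (abs_re_star_mul_le _ _)).2
  have h₃ : -((queryWeight lab ψ j + queryWeight lab φ j) / 2) ≤
      ∑ z : BasisState n b m d with lab z.1 z.2.1 = j,
        (star (ψ (queryMap enc A B z)) * φ (queryMap enc A' B' z)).re := by
    rw [queryWeight, queryWeight,
      ← sum_filter_queryMap enc A B (fun s i => lab s i = j) fun z => ‖ψ z‖ ^ 2,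
      ← sum_filter_queryMap enc A' B' (fun s i => lab s i = j) fun z => ‖φ z‖ ^ 2,
      ← Finset.sum_add_distrib, Finset.sum_div, ← Finset.sum_neg_distrib]
    exact Finset.sum_le_sum fun z _ => (abs_le.1 (abs_re_star_mul_le _ _)).1
  rw [h₁]
  linarith

namespace QueryAlgorithm

theorem norm_state (𝒜 : QueryAlgorithm n b m) (enc : α ↪ BitVec b) (A B : RLE α n) (t : ℕ) :
    ∑ z, ‖𝒜.state enc A B t z‖ ^ 2 = 1 := by
  induction t with
  | zero =>
    rw [← overlap_self, state, overlap_unitary, overlap_self, Finset.sum_eq_single 𝒜.init]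
    · simp
    · intro z _ hz; simp [hz]
    · simp
  | succ t ih =>
    rw [← overlap_self, state, overlap_unitary, overlap_self, ← ih]
    simp only [oracle_mulVec_apply]
    exact sum_queryMap enc A B fun z => ‖𝒜.state enc A B t z‖ ^ 2

theorem outputProb_mono (𝒜 : QueryAlgorithm n b m) (enc : α ↪ BitVec b) (A B : RLE α n)
    {E F : Set (Fin n × Fin n × ℕ)} (h : E ⊆ F) :
    𝒜.outputProb enc A B E ≤ 𝒜.outputProb enc A B F :=
  Finset.sum_le_sum fun z _ => Set.indicator_le_indicator_of_subset (Set.preimage_mono h)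
    (fun _ => by positivity) z

end QueryAlgorithm

/-! ### The adversary bound -/

/-- The sum over all pairs `(x, j)`, `x ⊆ {0, …, K - 1}` of size `t` and `j ∉ x`, reindexed by the
pair `(insert j x, j)`. -/
theorem sum_sdiff_insert (K t : ℕ) (f : Finset ℕ → ℕ → ℝ) :
    ∑ x ∈ (Finset.range K).powersetCard t, ∑ j ∈ Finset.range K \ x, f (insert j x) j =
      ∑ y ∈ (Finset.range K).powersetCard (t + 1), ∑ j ∈ y, f y j := by
  rw [Finset.sum_sigma', Finset.sum_sigma']
  refine Finset.sum_nbij' (fun p => ⟨insert p.2 p.1, p.2⟩) (fun p => ⟨p.1.erase p.2, p.2⟩)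
    ?_ ?_ ?_ ?_ ?_
  · rintro ⟨x, j⟩ h
    simp only [Finset.mem_sigma, Finset.mem_powersetCard, Finset.mem_sdiff] at h ⊢
    exact ⟨⟨Finset.insert_subset h.2.1 h.1.1, by rw [Finset.card_insert_of_notMem h.2.2, h.1.2]⟩,
      Finset.mem_insert_self _ _⟩
  · rintro ⟨y, j⟩ h
    simp only [Finset.mem_sigma, Finset.mem_powersetCard, Finset.mem_sdiff] at h ⊢
    exact ⟨⟨(Finset.erase_subset _ _).trans h.1.1, by
      rw [Finset.card_erase_of_mem h.2, h.1.2, Nat.add_sub_cancel]⟩, h.1.1 h.2,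
      Finset.notMem_erase _ _⟩
  · rintro ⟨x, j⟩ h
    simp only [Finset.mem_sigma, Finset.mem_sdiff] at h
    simp [h.2.2]
  · rintro ⟨y, j⟩ h
    simp only [Finset.mem_sigma] at h
    simp [Finset.insert_erase h.2]
  · rintro ⟨x, j⟩ _
    rfl

/-- The quantum adversary bound for distinguishing the inputs given by the `t`-element subsets of
`{0, …, K - 1}` from those given by the `(t + 1)`-element subsets, where every query reveals
whether one element belongs to the set. -/
theorem QueryAlgorithm.le_queries_of_distinguishes (𝒜 : QueryAlgorithm n b m) (enc : α ↪ BitVec b)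
    (A B : Finset ℕ → RLE α n) (K t : ℕ) (ht : t ≤ K) (lab : Bool → Fin n → ℕ)
    (hlab : ∀ x j s i, lab s i ≠ j →
      (bif s then B x else A x).char i = (bif s then B (insert j x) else A (insert j x)).char i ∧
      (bif s then B x else A x).run i = (bif s then B (insert j x) else A (insert j x)).run i)
    (E : Set (Fin n × Fin n × ℕ))
    (h₁ : ∀ x ∈ (Finset.range K).powersetCard t, 2 / 3 ≤ 𝒜.outputProb enc (A x) (B x) E)
    (h₂ : ∀ y ∈ (Finset.range K).powersetCard (t + 1),
      2 / 3 ≤ 𝒜.outputProb enc (A y) (B y) Eᶜ) :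
    (K - t : ℝ) * (t + 1) ≤ 18 * (K + 1) * 𝒜.queries := by
  set X := (Finset.range K).powersetCard t with hX
  set Y := (Finset.range K).powersetCard (t + 1) with hY
  let ψ : Finset ℕ → ℕ → BasisState n b m 𝒜.workDim → ℂ := fun x => 𝒜.state enc (A x) (B x)
  -- The progress measure: zero before any query, and at least `1 / 18` per pair at the end.
  let D : ℕ → ℝ := fun T =>
    ∑ x ∈ X, ∑ j ∈ Finset.range K \ x, (1 - overlap (ψ x T) (ψ (insert j x) T))
  have hnorm : ∀ x T, ∑ z, ‖ψ x T z‖ ^ 2 = 1 := fun x T => 𝒜.norm_state enc _ _ T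
  have hD0 : D 0 = 0 := by
    refine Finset.sum_eq_zero fun x _ => Finset.sum_eq_zero fun j _ => ?_
    have : ψ (insert j x) 0 = ψ x 0 := rfl
    rw [this, overlap_self, hnorm, sub_self]
  have hstep : ∀ T, D (T + 1) ≤ D T + (X.card + Y.card) := by
    intro T
    have e₁ : ∀ x j, 1 - overlap (ψ x (T + 1)) (ψ (insert j x) (T + 1)) ≤
        (1 - overlap (ψ x T) (ψ (insert j x) T)) +
          (queryWeight lab (ψ x T) j + queryWeight lab (ψ (insert j x) T) j) := by
      intro x j
      have := overlap_sub_overlap_oracle_le enc lab j (hlab x j) (ψ x T) (ψ (insert j x) T)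
      have e : overlap (ψ x (T + 1)) (ψ (insert j x) (T + 1)) =
          overlap ((oracle _ enc (A x) (B x)).mulVec (ψ x T))
            ((oracle _ enc (A (insert j x)) (B (insert j x))).mulVec (ψ (insert j x) T)) :=
        overlap_unitary _ _ _
      rw [e]
      linarith
    -- For a fixed `x` the labels `j` split one unit vector into disjoint parts, so their weights
    -- sum to at most 1. In `e₃` the same holds after grouping the pairs by their larger set.
    have e₂ : ∑ x ∈ X, ∑ j ∈ Finset.range K \ x, queryWeight lab (ψ x T) j ≤ X.card := by
      rw [← nsmul_one, ← Finset.sum_const]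
      exact Finset.sum_le_sum fun x _ => (sum_queryWeight_le lab _ _).trans (hnorm x T).le
    have e₃ : ∑ x ∈ X, ∑ j ∈ Finset.range K \ x, queryWeight lab (ψ (insert j x) T) j
        ≤ Y.card := by
      rw [sum_sdiff_insert K t fun y j => queryWeight lab (ψ y T) j, ← nsmul_one,
        ← Finset.sum_const]
      exact Finset.sum_le_sum fun x _ => (sum_queryWeight_le lab _ _).trans (hnorm x T).le
    have e₄ : D (T + 1) ≤ D T + (∑ x ∈ X, ∑ j ∈ Finset.range K \ x, queryWeight lab (ψ x T) j +
        ∑ x ∈ X, ∑ j ∈ Finset.range K \ x, queryWeight lab (ψ (insert j x) T) j) := by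
      simp only [D, ← Finset.sum_add_distrib]
      exact Finset.sum_le_sum fun x _ => Finset.sum_le_sum fun j _ => e₁ x j
    linarith
  have hDT : ∀ T : ℕ, D T ≤ T * (X.card + Y.card) := by
    intro T
    induction T with
    | zero => simp [hD0]
    | succ T ih => push_cast; linarith [hstep T]
  have hR₁ : ∑ x ∈ X, ∑ j ∈ Finset.range K \ x, (1 : ℝ) = X.card * (K - t) := by
    rw [← nsmul_eq_mul, ← Finset.sum_const]
    refine Finset.sum_congr rfl fun x hx => ?_
    obtain ⟨hx₁, hx₂⟩ := Finset.mem_powersetCard.1 hx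
    rw [Finset.sum_const, nsmul_one, Finset.card_sdiff_of_subset hx₁, hx₂, Finset.card_range,
      Nat.cast_sub ht]
  have hR₂ : ∑ x ∈ X, ∑ j ∈ Finset.range K \ x, (1 : ℝ) = Y.card * (t + 1) := by
    rw [sum_sdiff_insert K t fun _ _ => 1, ← nsmul_eq_mul, ← Finset.sum_const]
    refine Finset.sum_congr rfl fun y hy => ?_
    rw [Finset.sum_const, nsmul_one, (Finset.mem_powersetCard.1 hy).2]
    push_cast; rfl
  have hfinal : 1 / 18 * ∑ x ∈ X, ∑ j ∈ Finset.range K \ x, (1 : ℝ) ≤ D 𝒜.queries := by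
    rw [Finset.mul_sum]
    refine Finset.sum_le_sum fun x hx => ?_
    rw [Finset.mul_sum]
    refine Finset.sum_le_sum fun j hj => ?_
    obtain ⟨hx₁, hx₂⟩ := Finset.mem_powersetCard.1 hx
    obtain ⟨hj₁, hj₂⟩ := Finset.mem_sdiff.1 hj
    have hy : insert j x ∈ Y := Finset.mem_powersetCard.2
      ⟨Finset.insert_subset hj₁ hx₁, by rw [Finset.card_insert_of_notMem hj₂, hx₂]⟩
    have := overlap_le_of_distinguished (𝒜.output ⁻¹' E) (ψ x 𝒜.queries)
      (ψ (insert j x) 𝒜.queries) (hnorm _ _) (hnorm _ _) (h₁ x hx) (h₂ _ hy)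
    linarith
  have hXpos : 0 < (X.card : ℝ) := by
    rw [hX, Finset.card_powersetCard, Finset.card_range]
    exact_mod_cast Nat.choose_pos ht
  have hq := hDT 𝒜.queries
  rw [hR₁] at hfinal
  have hXY : (X.card : ℝ) * (K - t) = Y.card * (t + 1) := hR₁.symm.trans hR₂
  -- Double counting the pairs (`hXY`) turns `(t + 1) * (X.card + Y.card)` into `X.card * (K + 1)`,
  -- so that `X.card` cancels.
  have hmain : (X.card : ℝ) * ((K - t) * (t + 1)) ≤ X.card * (18 * (K + 1) * 𝒜.queries) := by
    have := mul_le_mul_of_nonneg_right (hfinal.trans hq) (by positivity : (0 : ℝ) ≤ 18 * (t + 1))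
    calc (X.card : ℝ) * ((K - t) * (t + 1)) = 1 / 18 * (X.card * (K - t)) * (18 * (t + 1)) := by
          ring
      _ ≤ _ := this
      _ = 18 * 𝒜.queries * (X.card * (t + 1) + Y.card * (t + 1)) := by ring
      _ = _ := by rw [← hXY]; ring
  exact le_of_mul_le_mul_left hmain hXpos

/-! ### Substrings of block words -/

/-- The concatenation of the blocks `c ⋯ c a` with `k + 1` copies of `c`, for `k` in `ks`. -/
def word (a c : α) (ks : List ℕ) : List α :=
  ks.flatMap fun k => List.replicate (k + 1) c ++ [a]

theorem word_cons (a c : α) (k : ℕ) (ks : List ℕ) :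
    word a c (k :: ks) = List.replicate (k + 1) c ++ a :: word a c ks := by
  simp [word]

theorem length_word (a c : α) (ks : List ℕ) :
    (word a c ks).length = 2 * ks.length + ks.sum := by
  induction ks with
  | nil => simp [word]
  | cons k ks ih => rw [word_cons]; simp [ih]; ring

theorem eq_of_prefix_word {a c y : α} {l : List α} {ks : List ℕ} (h : y :: l <+: word a c ks) :
    y = c := by
  cases ks with
  | nil => simp [word] at h
  | cons k ks =>
    rw [word_cons, List.replicate_succ, List.cons_append, List.cons_prefix_cons] at h
    exact h.1

/-- Every `a` inside the word is isolated, and the long final run of `a` is not followed by `c`. -/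
theorem not_infix_word {a c : α} (hac : a ≠ c) (M : ℕ) (ks : List ℕ) :
    ¬ [a, a, c] <:+: a :: (word a c ks ++ List.replicate M a) := by
  induction ks with
  | nil =>
    intro h
    have := h.subset (show c ∈ [a, a, c] by simp)
    simp [word, hac.symm] at this
  | cons k ks ih =>
    have aux : ∀ k, ¬ [a, a, c] <:+:
        List.replicate k c ++ a :: (word a c ks ++ List.replicate M a) := by
      intro k
      induction k with
      | zero => simpa using ih
      | succ k ihk =>
        rw [List.replicate_succ, List.cons_append, List.infix_cons_iff]
        rintro (h | h)
        · exact hac (List.cons_prefix_cons.1 h).1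
        · exact ihk h
    rw [word_cons, List.append_assoc, List.cons_append, List.infix_cons_iff]
    rintro (h | h)
    · rw [List.cons_prefix_cons, List.replicate_succ, List.cons_append, List.cons_prefix_cons] at h
      exact hac h.2.1
    · exact aux _ h

/-- A constant string cannot straddle the boundary, since `l` can only begin with `c`. Applied run
by run, this bounds constant substrings by the longest run. -/
theorem le_of_replicate_infix_append {y a c : α} (hac : a ≠ c) {r p M : ℕ} {l : List α}
    (hl : ∀ y t, y :: t <+: l → y = c) (hp : p ≤ M)
    (hM : List.replicate r y <:+: l → r ≤ M)
    (h : List.replicate r y <:+: List.replicate p a ++ l) : r ≤ M := by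
  rcases List.infix_append_iff_ne_nil.1 h with h | h | ⟨l₁, l₂, h₁, h₂, e, hs, hpre⟩
  · simpa using h.length_le.trans (by simpa using hp)
  · exact hM h
  · exfalso
    obtain ⟨u, t₁, rfl⟩ := List.exists_cons_of_ne_nil h₁
    obtain ⟨v, t₂, rfl⟩ := List.exists_cons_of_ne_nil h₂
    have hu : u = y := List.eq_of_mem_replicate (n := r) (by rw [e]; simp)
    have hv : v = y := List.eq_of_mem_replicate (n := r) (by rw [e]; simp)
    have hu' : u = a := List.eq_of_mem_replicate (hs.subset (by simp))
    exact hac (by rw [← hu', hu, ← hv, hl v t₂ hpre])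

theorem le_of_replicate_infix_cons_word {y a c : α} (hac : a ≠ c) {r M : ℕ} (hM : 1 ≤ M)
    {ks : List ℕ} (hks : ∀ k ∈ ks, k + 1 ≤ M) (h : List.replicate r y <:+: a :: word a c ks) :
    r ≤ M := by
  induction ks with
  | nil => simpa [word] using h.length_le.trans (by simpa [word] using hM)
  | cons k ks ih =>
    refine le_of_replicate_infix_append (p := 1) hac (fun _ _ => eq_of_prefix_word) hM (fun h => ?_) h
    rw [word_cons] at h
    refine le_of_replicate_infix_append hac.symm (fun y t h => (List.cons_prefix_cons.1 h).1)
      (hks k (by simp)) (fun h => ih (fun k hk => hks k (by simp [hk])) h) h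

theorem le_of_replicate_infix {y a c : α} (hac : a ≠ c) {r L : ℕ} (hL : 1 ≤ L)
    {ks : List ℕ} (hks : ∀ k ∈ ks, k + 1 ≤ L)
    (h : List.replicate r y <:+: List.replicate L a ++ word a c ks) : r ≤ L :=
  le_of_replicate_infix_append hac (fun _ _ => eq_of_prefix_word) le_rfl
    (fun h => le_of_replicate_infix_cons_word hac hL hks (List.infix_cons h)) h

/-- A common substring reaching from the long run of the first string into the word takes at most
one `a` from that run: two would produce `a a c`, which the second string avoids. -/
theorem replicate_or_length_le {a c : α} (hac : a ≠ c) {L M : ℕ} {ks : List ℕ} {s : List α}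
    (hA : s <:+: List.replicate L a ++ word a c ks)
    (hB : s <:+: a :: (word a c ks ++ List.replicate M a)) :
    (∀ y ∈ s, y = a) ∨ s.length ≤ (word a c ks).length + 1 := by
  rcases List.infix_append_iff_ne_nil.1 hA with h | h | ⟨l₁, l₂, h₁, h₂, rfl, hs, hp⟩
  · exact Or.inl fun y hy => List.eq_of_mem_replicate (h.subset hy)
  · exact Or.inr (h.length_le.trans (Nat.le_succ _))
  · right
    have hl₁ : l₁ = List.replicate l₁.length a :=
      List.eq_replicate_iff.2 ⟨rfl, fun y hy => List.eq_of_mem_replicate (hs.subset hy)⟩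
    obtain ⟨v, t, rfl⟩ := List.exists_cons_of_ne_nil h₂
    obtain rfl := eq_of_prefix_word hp
    have hlen : l₁.length ≤ 1 := by
      by_contra! hlt
      obtain ⟨j, hj⟩ := Nat.exists_eq_add_of_le' hlt
      refine not_infix_word hac M ks (List.IsInfix.trans ⟨List.replicate j a, t, ?_⟩ hB)
      rw [hl₁, hj, show j + Nat.succ 1 = j + 2 from rfl, List.replicate_add]
      simp
    have := hp.length_le
    rw [List.length_append]
    omega

/-! ### Alternating strings encoding a set -/

/-- The character of run `i` of the alternating string `a c a c ⋯`. -/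
def altChar (a c : α) (i : ℕ) : α := if i % 2 = 0 then a else c

/-- Run lengths encoding the set `x`: run `2 * j + 1` has length `5` if `j ∈ x`, and all other runs
have length `1`. -/
def setRun (x : Finset ℕ) (i : ℕ) : ℕ := if i % 2 = 1 ∧ i / 2 ∈ x then 5 else 1

theorem setRun_pos (x : Finset ℕ) (i : ℕ) : 0 < setRun x i := by
  unfold setRun; split_ifs <;> norm_num

theorem setRun_insert {x : Finset ℕ} {i j : ℕ} (h : i / 2 ≠ j) :
    setRun (insert j x) i = setRun x i := by
  simp [setRun, h]

theorem altChar_ne {a c : α} (hac : a ≠ c) (i : ℕ) : altChar a c i ≠ altChar a c (i + 1) := by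
  unfold altChar
  rcases Nat.mod_two_eq_zero_or_one i with h | h
  · rw [if_pos h, if_neg (by omega)]; exact hac
  · rw [if_neg (by omega), if_pos (by omega)]; exact hac.symm

/-- The runs `s, …, s + k - 1` of the alternating string with run lengths `setRun x`, decoded. -/
def segment (a c : α) (x : Finset ℕ) (s k : ℕ) : List α :=
  (List.range' s k).flatMap fun i => List.replicate (setRun x i) (altChar a c i)

theorem segment_add (a c : α) (x : Finset ℕ) (s k l : ℕ) :
    segment a c x s (k + l) = segment a c x s k ++ segment a c x (s + k) l := by
  rw [segment, segment, segment, ← List.flatMap_append, List.range'_append_1]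

theorem segment_one (a c : α) (x : Finset ℕ) (s : ℕ) :
    segment a c x s 1 = List.replicate (setRun x s) (altChar a c s) := by
  simp [segment]

theorem segment_one_even (a c : α) (x : Finset ℕ) {s : ℕ} (h : s % 2 = 0) :
    segment a c x s 1 = [a] := by
  simp [segment_one, setRun, altChar, h]

/-- The sequence encoding the membership of `0, …, K - 1` in `x`. -/
def setCode (x : Finset ℕ) (K : ℕ) : List ℕ := (List.range K).map fun j => if j ∈ x then 4 else 0

theorem setCode_succ (x : Finset ℕ) (K : ℕ) :
    setCode x (K + 1) = setCode x K ++ [if K ∈ x then 4 else 0] := by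
  simp [setCode, List.range_succ]

theorem setCode_le {x : Finset ℕ} {K k : ℕ} (h : k ∈ setCode x K) : k ≤ 4 := by
  simp only [setCode, List.mem_map] at h
  obtain ⟨j, -, rfl⟩ := h
  split_ifs <;> norm_num

theorem sum_setCode {x : Finset ℕ} {K : ℕ} (h : x ⊆ Finset.range K) :
    (setCode x K).sum = 4 * x.card := by
  have key : ∀ K, (setCode x K).sum = 4 * ((Finset.range K).filter (· ∈ x)).card := by
    intro K
    induction K with
    | zero => simp [setCode]
    | succ K ih =>
      rw [setCode_succ, List.sum_append, ih, Finset.range_add_one, Finset.filter_insert]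
      split_ifs <;> simp [mul_add]
  rw [key, Finset.filter_mem_eq_inter, Finset.inter_eq_right.2 h]

/-- Runs `2 * j + 1` and `2 * j + 2` together form the block of element `j`. -/
theorem segment_eq_word (a c : α) (x : Finset ℕ) (K : ℕ) :
    segment a c x 1 (2 * K) = word a c (setCode x K) := by
  induction K with
  | zero => simp [segment, setCode, word]
  | succ K ih =>
    rw [Nat.mul_succ, segment_add, ih, segment_add a c x (1 + 2 * K) 1 1,
      segment_one_even a c x (s := 1 + 2 * K + 1) (by omega), segment_one, setCode_succ, word, word,
      List.flatMap_append]
    have h₁ : (1 + 2 * K) % 2 = 1 := by omega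
    have h₂ : (1 + 2 * K) / 2 = K := by omega
    simp only [setRun, altChar, h₁, h₂]
    by_cases h : K ∈ x <;> simp [h]

theorem decode_eq {n : ℕ} (S : RLE α n) (g : ℕ → List α)
    (h : ∀ i : Fin n, List.replicate (S.run i) (S.char i) = g i) :
    S.decode = (List.range n).flatMap g := by
  rw [RLE.decode, List.flatMap_def, List.ofFn_eq_map, ← List.map_coe_finRange_eq_range,
    List.map_map]
  simp [h, Function.comp_def]

/-! ### The hard inputs -/

/-- The first input: the run `a ⋯ a` of length `L`, followed by runs encoding `x`. -/
def inputA (n : ℕ) {a c : α} (hac : a ≠ c) (L : ℕ) (x : Finset ℕ) : RLE α n where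
  char i := altChar a c i
  run i := if (i : ℕ) = 0 then L + 1 else setRun x i
  run_pos i := by
    split_ifs
    · exact Nat.succ_pos L
    · exact setRun_pos x i
  maximal i j h := by rw [h]; exact altChar_ne hac i

/-- The second input: runs encoding `x`, followed by the run `a ⋯ a` of length `L`. -/
def inputB (n : ℕ) {a c : α} (hac : a ≠ c) (L : ℕ) (x : Finset ℕ) : RLE α n where
  -- The shift makes the index of the last run even, so that this run consists of letters `a` for
  -- either parity of `n`.
  char i := altChar a c (i + (n + 1) % 2)
  run i := if (i : ℕ) + 1 = n then L + 1 else setRun x (i + (n + 1) % 2)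
  run_pos i := by
    split_ifs
    · exact Nat.succ_pos L
    · exact setRun_pos x _
  maximal i j h := by
    rw [h, show (i : ℕ) + 1 + (n + 1) % 2 = i + (n + 1) % 2 + 1 by ring]
    exact altChar_ne hac _

theorem decode_inputA (n : ℕ) {a c : α} (hac : a ≠ c) (L : ℕ) (x : Finset ℕ) :
    (inputA (n + 1) hac L x).decode = List.replicate (L + 1) a ++ segment a c x 1 n := by
  rw [decode_eq _ (fun i => List.replicate (if i = 0 then L + 1 else setRun x i) (altChar a c i))
    fun _ => rfl, List.range_eq_range', List.range'_succ, List.flatMap_cons]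
  congr 1
  rw [segment, List.flatMap_def, List.flatMap_def]
  congr 1
  refine List.map_congr_left fun i hi => ?_
  rw [List.mem_range'_1] at hi
  rw [if_neg (by omega)]

theorem decode_inputB (n : ℕ) {a c : α} (hac : a ≠ c) (L : ℕ) (x : Finset ℕ) :
    (inputB (n + 1) hac L x).decode =
      segment a c x (n % 2) n ++ List.replicate (L + 1) a := by
  have hn : (n + 1 + 1) % 2 = n % 2 := by omega
  rw [decode_eq _ (fun i => List.replicate (if i + 1 = n + 1 then L + 1 else setRun x (i + n % 2))
    (altChar a c (i + n % 2))) (fun i => by simp only [inputB, hn]), List.range_succ,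
    List.flatMap_append]
  congr 1
  · rw [segment, List.range'_eq_map_range, List.flatMap_map, List.flatMap_def, List.flatMap_def]
    congr 1
    refine List.map_congr_left fun i hi => ?_
    rw [List.mem_range] at hi
    rw [if_neg (by omega), add_comm (n % 2)]
  · have : (n + n % 2) % 2 = 0 := by omega
    simp only [List.flatMap_cons, List.flatMap_nil, altChar, if_pos this, if_true, List.append_nil]

theorem word_setCode_eq_append (a c : α) (x : Finset ℕ) {K : ℕ} (hK : 0 < K) :
    word a c (setCode x K) = segment a c x 1 (2 * K - 1) ++ [a] := by
  rw [← segment_eq_word, ← segment_one_even a c x (s := 1 + (2 * K - 1)) (by omega),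
    ← segment_add, Nat.sub_add_cancel (by omega)]

theorem length_word_setCode (a c : α) {x : Finset ℕ} {K : ℕ} (h : x ⊆ Finset.range K) :
    (word a c (setCode x K)).length = 2 * K + 4 * x.card := by
  rw [length_word, sum_setCode h]
  simp [setCode]

/-- For odd `n` the full word fits; for even `n` its final `a` is missing. Upper bounds only need
the longer string. -/
theorem inputA_infix {a c : α} (hac : a ≠ c) {n K : ℕ} (hn : n / 2 = K) (hK : 0 < K) (L : ℕ)
    (x : Finset ℕ) : (inputA n hac L x).decode <:+:
      List.replicate (L + 1) a ++ word a c (setCode x K) := by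
  obtain ⟨n, rfl⟩ := Nat.exists_eq_succ_of_ne_zero (show n ≠ 0 by omega)
  obtain ⟨r, hr⟩ := Nat.exists_eq_add_of_le (show n ≤ 2 * K by omega)
  rw [decode_inputA, ← segment_eq_word, hr, segment_add, ← List.append_assoc]
  exact List.infix_append_left

/-- The final `a` of the word merges with the long run, which is why `L` rather than `L + 1` copies
follow. For odd `n` the run numbering starts at 0, which puts an extra `a` in front. -/
theorem inputB_eq {a c : α} (hac : a ≠ c) {n K : ℕ} (hn : n / 2 = K) (hK : 0 < K) (L : ℕ)
    (x : Finset ℕ) : (inputB n hac L x).decode =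
      (if n % 2 = 1 then [a] else []) ++ word a c (setCode x K) ++ List.replicate L a := by
  obtain ⟨n, rfl⟩ := Nat.exists_eq_succ_of_ne_zero (show n ≠ 0 by omega)
  rw [decode_inputB, word_setCode_eq_append a c x hK]
  rcases Nat.mod_two_eq_zero_or_one n with h | h
  · rw [if_pos (by omega), h, show n = 1 + (2 * K - 1) by omega, segment_add,
      segment_one_even a c x rfl]
    simp [List.replicate_succ]
  · rw [if_neg (by omega), h, show n = 2 * K - 1 by omega]
    simp [List.replicate_succ]

theorem inputB_infix {a c : α} (hac : a ≠ c) {n K : ℕ} (hn : n / 2 = K) (hK : 0 < K) (L : ℕ)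
    (x : Finset ℕ) : (inputB n hac L x).decode <:+:
      a :: (word a c (setCode x K) ++ List.replicate L a) := by
  rw [inputB_eq hac hn hK]
  split_ifs
  · simp
  · simpa using List.infix_append_right (l₁ := [a])

theorem segment_infix_inputA {a c : α} (hac : a ≠ c) {n K : ℕ} (hn : n / 2 = K) (hK : 0 < K)
    (L : ℕ) (x : Finset ℕ) : segment a c x 1 (2 * K - 1) <:+: (inputA n hac L x).decode := by
  obtain ⟨n, rfl⟩ := Nat.exists_eq_succ_of_ne_zero (show n ≠ 0 by omega)
  obtain ⟨r, rfl⟩ := Nat.exists_eq_add_of_le (show 2 * K - 1 ≤ n by omega)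
  rw [decode_inputA, segment_add]
  exact List.infix_append' _ _ _

theorem segment_infix_inputB {a c : α} (hac : a ≠ c) {n K : ℕ} (hn : n / 2 = K) (hK : 0 < K)
    (L : ℕ) (x : Finset ℕ) : segment a c x 1 (2 * K - 1) <:+: (inputB n hac L x).decode := by
  rw [inputB_eq hac hn hK, word_setCode_eq_append a c x hK]
  simp only [List.append_assoc]
  exact List.infix_append' _ _ _

theorem replicate_infix_inputA {a c : α} (hac : a ≠ c) {n : ℕ} (hn : 0 < n) (L : ℕ)
    (x : Finset ℕ) : List.replicate (L + 1) a <:+: (inputA n hac L x).decode := by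
  obtain ⟨n, rfl⟩ := Nat.exists_eq_succ_of_ne_zero hn.ne'
  rw [decode_inputA]
  exact List.infix_append_left

theorem replicate_infix_inputB {a c : α} (hac : a ≠ c) {n : ℕ} (hn : 0 < n) (L : ℕ)
    (x : Finset ℕ) : List.replicate (L + 1) a <:+: (inputB n hac L x).decode := by
  obtain ⟨n, rfl⟩ := Nat.exists_eq_succ_of_ne_zero hn.ne'
  rw [decode_inputB]
  exact List.infix_append_right

theorem char_mem_decode {n : ℕ} (S : RLE α n) (i : Fin n) : S.char i ∈ S.decode :=
  List.mem_flatten.2 ⟨_, List.mem_ofFn.2 ⟨i, rfl⟩,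
    List.mem_replicate.2 ⟨(S.run_pos i).ne', rfl⟩⟩

/-! ### The number of runs of a longest common substring -/

/-- A run-length encoding of a constant string has at most one run. -/
theorem encodedLength_le_one {l : ℕ} (S : RLE α l) {a : α} (h : ∀ y ∈ S.decode, y = a) :
    l ≤ 1 := by
  by_contra! hl
  exact S.maximal ⟨0, by omega⟩ ⟨1, hl⟩ rfl
    ((h _ (char_mem_decode S _)).trans (h _ (char_mem_decode S _)).symm)

theorem decode_of_le_one {l : ℕ} (S : RLE α l) (hl : l ≤ 1) (a : α) :
    ∃ r y, S.decode = List.replicate r y := by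
  interval_cases l
  -- With no runs the string is empty and the character is arbitrary.
  · exact ⟨0, a, by simp [RLE.decode]⟩
  · exact ⟨S.run 0, S.char 0, by simp [RLE.decode]⟩

/-- If the run `a ⋯ a` is longer than the string encoding `x`, then every longest common substring
of the two inputs has at most one run. -/
theorem le_one_of_isAnswer {a c : α} (hac : a ≠ c) {n K L : ℕ} (hn : n / 2 = K) (hK : 0 < K)
    {x : Finset ℕ} (hx : x ⊆ Finset.range K) (hL : 2 * K + 4 * x.card < L)
    {o : Fin n × Fin n × ℕ} (ho : IsAnswer (inputA n hac L x) (inputB n hac L x) o) :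
    o.2.2 ≤ 1 := by
  obtain ⟨S, ⟨hA, hB, hmax⟩, -, -⟩ := ho
  have h := hmax _ (replicate_infix_inputA hac (by omega) L x)
    (replicate_infix_inputB hac (by omega) L x)
  rw [List.length_replicate] at h
  rcases replicate_or_length_le hac (hA.trans (inputA_infix hac hn hK L x))
    (hB.trans (inputB_infix hac hn hK L x)) with h' | h'
  · exact encodedLength_le_one S h'
  · rw [length_word_setCode a c hx] at h'
    omega

/-- If the string encoding `x` is longer than the run `a ⋯ a`, then every longest common substring
of the two inputs has at least two runs. -/
theorem not_le_one_of_isAnswer {a c : α} (hac : a ≠ c) {n K L : ℕ} (hn : n / 2 = K) (hK : 0 < K)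
    {x : Finset ℕ} (hx : x ⊆ Finset.range K) (hL4 : 4 ≤ L)
    (hL : L + 2 < 2 * K + 4 * x.card)
    {o : Fin n × Fin n × ℕ} (ho : IsAnswer (inputA n hac L x) (inputB n hac L x) o) :
    ¬ o.2.2 ≤ 1 := by
  intro hle
  obtain ⟨S, ⟨hA, hB, hmax⟩, -, -⟩ := ho
  obtain ⟨r, y, hS⟩ := decode_of_le_one S hle a
  rw [hS] at hA hmax
  -- The runs of `c` have length at most 5, so `4 ≤ L` makes `L + 1` the longest run of the first
  -- input.
  have h₁ := le_of_replicate_infix hac (Nat.succ_pos L)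
    (fun k hk => Nat.succ_le_succ ((setCode_le hk).trans hL4))
    (hA.trans (inputA_infix hac hn hK L x))
  -- The competitor is the word without its final `a`, which both inputs contain for either parity
  -- of `n`.
  have h₂ := hmax _ (segment_infix_inputA hac hn hK L x) (segment_infix_inputB hac hn hK L x)
  have h₃ := length_word_setCode a c hx
  rw [word_setCode_eq_append a c x hK] at h₃
  simp only [List.length_append, List.length_replicate, List.length_singleton] at h₂ h₃
  omega

theorem length_inputA_le {a c : α} (hac : a ≠ c) {n K : ℕ} (hn : n / 2 = K) (hK : 0 < K)
    (L : ℕ) {x : Finset ℕ} (hx : x ⊆ Finset.range K) :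
    (inputA n hac L x).decode.length ≤ L + 2 * K + 4 * x.card + 1 := by
  have := (inputA_infix hac hn hK L x).length_le
  rw [List.length_append, List.length_replicate, length_word_setCode a c hx] at this
  omega

theorem length_inputB_le {a c : α} (hac : a ≠ c) {n K : ℕ} (hn : n / 2 = K) (hK : 0 < K)
    (L : ℕ) {x : Finset ℕ} (hx : x ⊆ Finset.range K) :
    (inputB n hac L x).decode.length ≤ L + 2 * K + 4 * x.card + 1 := by
  have := (inputB_infix hac hn hK L x).length_le
  rw [List.length_cons, List.length_append, List.length_replicate,
    length_word_setCode a c hx] at this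
  omega

theorem exists_common_char {a c : α} (hac : a ≠ c) {n : ℕ} (hn : 0 < n) (L : ℕ) (x : Finset ℕ) :
    ∃ y, y ∈ (inputA n hac L x).decode ∧ y ∈ (inputB n hac L x).decode :=
  ⟨a, (replicate_infix_inputA hac hn L x).subset (by simp),
    (replicate_infix_inputB hac hn L x).subset (by simp)⟩

/-! ### The reduction and the linear bound -/

/-- The number of the element of the encoded set on which run `i` of the first (`s = false`) or
second (`s = true`) input may depend. -/
def elementLabel (n : ℕ) (s : Bool) (i : Fin n) : ℕ :=
  bif s then (i + (n + 1) % 2) / 2 else i / 2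

theorem inputs_insert {a c : α} (hac : a ≠ c) (n L : ℕ) (x : Finset ℕ) (j : ℕ) (s : Bool)
    (i : Fin n) (h : elementLabel n s i ≠ j) :
    (bif s then inputB n hac L x else inputA n hac L x).char i =
        (bif s then inputB n hac L (insert j x) else inputA n hac L (insert j x)).char i ∧
      (bif s then inputB n hac L x else inputA n hac L x).run i =
        (bif s then inputB n hac L (insert j x) else inputA n hac L (insert j x)).run i := by
  cases s
  · exact ⟨rfl, by simp only [cond_false, inputA, setRun_insert (x := x) h]⟩
  · exact ⟨rfl, by simp only [cond_true, inputB, setRun_insert (x := x) h]⟩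

/-- The linear lower bound on the number of queries for LCS-RLE. -/
theorem QueryAlgorithm.SolvesLCSRLE.div_two_le [Nontrivial α] {n b N m : ℕ} {enc : α ↪ BitVec b}
    {𝒜 : QueryAlgorithm n b m} (h𝒜 : 𝒜.SolvesLCSRLE enc N) (hn : 4 ≤ n) (hN : 8 * n ≤ N) :
    n / 2 ≤ 72 * 𝒜.queries := by
  obtain ⟨a, c, hac⟩ := exists_pair_ne α
  obtain ⟨K, hK⟩ : ∃ K, n / 2 = K := ⟨_, rfl⟩
  -- The middle layer makes both `K - t` and `t + 1` at least about `K / 2`, whence the constant `72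
  -- = 18 * 4`.
  obtain ⟨t, ht⟩ : ∃ t, K / 2 = t := ⟨_, rfl⟩
  -- `L = 2 * K + 4 * t + 1` is the only value with `2 * K + 4 * t < L` and `L + 2 < 2 * K + 4 * (t
  -- + 1)`; run lengths 5 and 1 leave just enough room for it.
  have hsolve : ∀ x ∈ (Finset.range K).powerset, x.card ≤ t + 1 →
      2 / 3 ≤ 𝒜.outputProb enc (inputA n hac (2 * K + 4 * t + 1) x)
        (inputB n hac (2 * K + 4 * t + 1) x)
        {o | IsAnswer (inputA n hac (2 * K + 4 * t + 1) x)
          (inputB n hac (2 * K + 4 * t + 1) x) o} := by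
    intro x hx hcard
    rw [Finset.mem_powerset] at hx
    refine h𝒜 _ _ ?_ ?_ (exists_common_char hac (by omega) _ x)
    · refine (length_inputA_le hac hK (by omega) _ hx).trans ?_
      omega
    · refine (length_inputB_le hac hK (by omega) _ hx).trans ?_
      omega
  have key := 𝒜.le_queries_of_distinguishes enc (inputA n hac (2 * K + 4 * t + 1))
    (inputB n hac (2 * K + 4 * t + 1)) K t (by omega) (elementLabel n)
    (inputs_insert hac n (2 * K + 4 * t + 1)) {o | o.2.2 ≤ 1}
    (fun x hx => by
      obtain ⟨hx, hcard⟩ := Finset.mem_powersetCard.1 hx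
      exact (hsolve x (Finset.mem_powerset.2 hx) (by omega)).trans (𝒜.outputProb_mono enc _ _
        fun o ho => le_one_of_isAnswer hac hK (by omega) hx (by omega) ho))
    (fun x hx => by
      obtain ⟨hx, hcard⟩ := Finset.mem_powersetCard.1 hx
      exact (hsolve x (Finset.mem_powerset.2 hx) hcard.le).trans (𝒜.outputProb_mono enc _ _
        fun o ho => not_le_one_of_isAnswer hac hK (by omega) hx (by omega) (by omega) ho))
  rw [hK]
  have h₁ : (K : ℝ) ≤ 2 * (K - t) := by
    have : K + 2 * t ≤ 2 * K := by omega
    have : (K : ℝ) + 2 * t ≤ 2 * K := by exact_mod_cast this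
    linarith
  have h₂ : (K : ℝ) + 1 ≤ 2 * (t + 1) := by
    have : K + 1 ≤ 2 * (t + 1) := by omega
    exact_mod_cast this
  have h₃ : (K : ℝ) * (K + 1) ≤ 2 * (K - t) * (2 * (t + 1)) :=
    mul_le_mul h₁ h₂ (by positivity) ((Nat.cast_nonneg K).trans h₁)
  have h₄ : (K : ℝ) * (K + 1) ≤ 72 * 𝒜.queries * (K + 1) := by linarith
  exact_mod_cast le_of_mul_le_mul_right h₄ (by positivity)

end LCSRLE

theorem mainTheorem8 :
    ∃ c : ℝ, 0 < c ∧ ∃ n₀ : ℕ, ∀ n : ℕ, n₀ ≤ n →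
      ∀ (α : Type*) [Nontrivial α] (b : ℕ) (enc : α ↪ BitVec b)
        (N m : ℕ), 8 * n ≤ N → N < 2 ^ m →
        ∀ 𝒜 : LCSRLE.QueryAlgorithm n b m, 𝒜.SolvesLCSRLE enc N →
          c * ((n : ℝ) / Real.log n ^ 2) ≤ (𝒜.queries : ℝ) := by
  refine ⟨1 / 288, by norm_num, 4, fun n hn α _ b enc N m hN _ 𝒜 h𝒜 => ?_⟩
  have h : (n : ℝ) ≤ 288 * 𝒜.queries := by
    have := h𝒜.div_two_le hn hN
    -- Rounding in `n / 2` costs at most 1, absorbed because `n ≥ 4` forces at least one query.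
    exact_mod_cast (show n ≤ 288 * 𝒜.queries by omega)
  have hlog : 1 ≤ Real.log n := by
    rw [Real.le_log_iff_exp_le (by positivity)]
    have : (4 : ℝ) ≤ n := by exact_mod_cast hn
    linarith [Real.exp_one_lt_d9]
  have := div_le_self (Nat.cast_nonneg (α := ℝ) n) (one_le_pow₀ (n := 2) hlog)
  linarith
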